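/- **Theorem 1.** Let $\mathcal X\subset\mathbb R^p$ and $\mathcal Y\subset\mathbb R$ be compact, and let $\mathcal H$ be a reproducing kernel Hilbert space of real functions on $\mathcal X$ whose kernel $\kappa$ is measurable and satisfies $\sup_{x\in\mathcal X}\sqrt{\kappa(x,x)}<\infty$. Let $\ell:\mathbb R\times\mathcal Y\to\mathbb R$, $(z,y)\mapsto\ell(z,y)$, be measurable in $y$, and suppose that for every $y\in\mathcal Y$ the function $\ell(\cdot,y)$ is convex, differentiable and $C$-Lipschitz on $\mathbb R$, with the same constant $C$ for all $y$; write $\ell'$ for its derivative in $z$. Let $(x_t,y_t)_{t\ge 0}$ be i.i.d. random pairs in $\mathcal X\times\mathcal Y$ with the law of $(x,y)$, let $\lambda>0$, and let $$R(f)=\mathbb E[\ell(f(x),y)]+\tfrac{\lambda}{2}\|f\|_{\mathcal H}^2,\qquad f\in\mathcal H,$$ where $\ell(f(x),y)$ is assumed integrable for every $f\in\mathcal H$. Let $f^*$ be a minimizer of $R$ over $\mathcal H$. Let $(f_t)_{t\ge0}$ be generated by Parsimonious Online Learning with Kernels (POLK) with step sizes $\eta_t>0$ and budgets $\varepsilon_t>0$.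 That is, $f_0=0$ with empty dictionary, and, given $f_t=\sum_{n=1}^{M_t} w_n\kappa(d_n,\cdot)$, one forms $$\tilde f_{t+1}=(1-\eta_t\lambda)f_t-\eta_t\,\ell'(f_t(x_t),y_t)\,\kappa(x_t,\cdot),$$ with dictionary $[d_1,\dots,d_{M_t},x_t]$ and coefficients $[(1-\eta_t\lambda)w_1,\dots,(1-\eta_t\lambda)w_{M_t},\,-\eta_t\ell'(f_t(x_t),y_t)]$. Then $f_{t+1}$, with its dictionary and coefficients, is the output of destructive kernel orthogonal matching pursuit (KOMP) run on $\tilde f_{t+1}$ with budget $\varepsilon_t$: as long as the current dictionary is non-empty, for each of its elements $d_j$ compute the least error $\gamma_j=\min_{w}\big\|\tilde f_{t+1}-\sum_{k\ne j}w_k\kappa(d_k,\cdot)\big\|_{\mathcal H}$ attainable without $d_j$, and choose $j^*$ minimizing $\gamma_j$; if $\gamma_{j^*}>\varepsilon_t$, stop and return the current function; otherwise remove $d_{j^*}$, replace the coefficients by ones minimizing the Hilbert-norm error to $\tilde f_{t+1}$ over the remaining dictionary, and repeat. Ties among minimizers may be broken arbitrarily. Suppose that $$\sum_{t}\eta_t=\infty,\qquad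 \sum_t\eta_t^2<\infty,\qquad \varepsilon_t=\eta_t^2,\qquad \eta_t<\frac1\lambda\ \text{ for all } t.$$ Then $$\liminf_{t\to\infty}R(f_t)-R(f^*)=0\quad\text{almost surely},\qquad\text{and}\qquad \lim_{t\to\infty}\|f_t-f^*\|_{\mathcal H}^2=0\quad\text{almost surely}.$$ -/

import Mathlib

open MeasureTheory ProbabilityTheory Filter Topology

/-- A finite kernel expansion: a dictionary `d₁, …, d_M` of points of `X` (`M` is the model order)
together with coefficients `w₁, …, w_M`. -/
structure KernelExpansion (X : Type*) where
  order : ℕ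
  dict : Fin order → X
  coeff : Fin order → ℝ

section RKHSNotions

variable {X : Type*} (H : Type*) [NormedAddCommGroup H] [InnerProductSpace ℝ H] [CompleteSpace H]
  [RKHS ℝ H X ℝ]

/-- The scalar reproducing kernel `κ(x, x')` of `H`. -/
noncomputable def reproducingKernel (x x' : X) : ℝ := RKHS.kernel H x x' 1

/-- The element `κ(x, ·)` of `H`. -/
noncomputable def kernelSection (x : X) : H := RKHS.kerFun H x 1

/-- The function `∑ n, w n • κ(d n, ·)` of `H` with dictionary `d` and coefficients `w`. -/
noncomputable def kernelSum {M : ℕ} (d : Fin M → X) (w : Fin M → ℝ) : H :=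
  ∑ n, w n • kernelSection H (d n)

/-- The element of `H` represented by a kernel expansion. -/
noncomputable def KernelExpansion.toRKHS (A : KernelExpansion X) : H :=
  kernelSum H A.dict A.coeff

theorem reproducingKernel_eq_kernelSection_apply (x x' : X) :
    reproducingKernel H x x' = kernelSection H x' x := by
  simp [reproducingKernel, kernelSection, RKHS.kerFun_apply]

variable {H}

/-- The reproducing property `⟨f, κ(x, ·)⟩ = f(x)`. -/
theorem inner_kernelSection (f : H) (x : X) : inner ℝ f (kernelSection H x) = f x := by
  simp [kernelSection]

/-- The weights `w` minimize the Hilbert-norm error in approximating `g` over the dictionary `d`. -/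
def IsBestCoeff (g : H) {M : ℕ} (d : Fin M → X) (w : Fin M → ℝ) : Prop :=
  ∀ v : Fin M → ℝ, ‖g - kernelSum H d w‖ ≤ ‖g - kernelSum H d v‖

/-- The approximation error `γ_j` of `g` after the dictionary element `d j` is removed. -/
noncomputable def removalError (g : H) {M : ℕ} (d : Fin (M + 1) → X) (j : Fin (M + 1)) : ℝ :=
  ⨅ w : Fin M → ℝ, ‖g - kernelSum H (j.removeNth d) w‖

/-- The loop of destructive kernel orthogonal matching pursuit with pre-fitting, for the target
function `g` and the error budget `ε`: `KOMPLoop g ε A B` says that the loop, entered with the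
current expansion `A`, can return `B`. Ties in the choice of the removed element and of the weights
may be broken in any way. -/
inductive KOMPLoop (g : H) (ε : ℝ) : KernelExpansion X → KernelExpansion X → Prop
  | empty (d : Fin 0 → X) (w : Fin 0 → ℝ) : KOMPLoop g ε ⟨0, d, w⟩ ⟨0, d, w⟩
  | halt {M : ℕ} (d : Fin (M + 1) → X) (w : Fin (M + 1) → ℝ) (j : Fin (M + 1))
      (argmin : ∀ i, removalError g d j ≤ removalError g d i)
      (exceeds : ε < removalError g d j) :
      KOMPLoop g ε ⟨M + 1, d, w⟩ ⟨M + 1, d, w⟩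
  | prune {M : ℕ} (d : Fin (M + 1) → X) (w : Fin (M + 1) → ℝ) (j : Fin (M + 1))
      (argmin : ∀ i, removalError g d j ≤ removalError g d i)
      (within : removalError g d j ≤ ε)
      (w' : Fin M → ℝ) (refit : IsBestCoeff g (j.removeNth d) w')
      (B : KernelExpansion X) (rest : KOMPLoop g ε ⟨M, j.removeNth d, w'⟩ B) :
      KOMPLoop g ε ⟨M + 1, d, w⟩ B

variable (H) in
/-- `B` is an output of destructive KOMP run on the function represented by `A`, with the dictionary
and coefficients of `A` and error budget `ε`. -/
def KOMP (ε : ℝ) (A B : KernelExpansion X) : Prop := KOMPLoop (A.toRKHS H) ε A B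

variable {Y : Type*}

/-- The derivative `ℓ'(z, y)` of the loss in its first, scalar, argument. -/
noncomputable def lossDeriv (loss : ℝ → Y → ℝ) (z : ℝ) (y : Y) : ℝ := deriv (fun u => loss u y) z

variable (H) in
/-- The unconstrained functional stochastic gradient step: append the sample `x` to the dictionary,
scale the old coefficients by `1 - ηλ` and give `x` the coefficient `-η ℓ'(f(x), y)`. -/
noncomputable def sgdStep (loss : ℝ → Y → ℝ) (lam η : ℝ) (A : KernelExpansion X) (x : X) (y : Y) :
    KernelExpansion X where
  order := A.order + 1
  dict := Fin.snoc A.dict x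
  coeff := Fin.snoc (fun n => (1 - η * lam) * A.coeff n) (-(η * lossDeriv loss (A.toRKHS H x) y))

/-- The step represents `(1 - ηλ) f - η ℓ'(f(x), y) κ(x, ·)`. -/
theorem toRKHS_sgdStep (loss : ℝ → Y → ℝ) (lam η : ℝ) (A : KernelExpansion X) (x : X) (y : Y) :
    (sgdStep H loss lam η A x y).toRKHS H =
      (1 - η * lam) • A.toRKHS H - (η * lossDeriv loss (A.toRKHS H x) y) • kernelSection H x := by
  have h : (sgdStep H loss lam η A x y).toRKHS H =
      ∑ n : Fin (A.order + 1), (Fin.snoc (α := fun _ => ℝ) (fun n => (1 - η * lam) * A.coeff n)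
        (-(η * lossDeriv loss (A.toRKHS H x) y)) n : ℝ) •
          kernelSection H (Fin.snoc (α := fun _ => X) A.dict x n) := rfl
  have hA : A.toRKHS H = ∑ n, A.coeff n • kernelSection H (A.dict n) := rfl
  rw [h, Fin.sum_univ_castSucc]
  simp only [Fin.snoc_castSucc, Fin.snoc_last, mul_smul, ← Finset.smul_sum, ← hA, neg_smul]
  exact (sub_eq_add_neg _ _).symm

variable (H) in
/-- `A 0, A 1, …` are the expansions of a run of POLK on the training stream `z` with step sizes
`η`, error budgets `ε` and regularizer `lam`, started at the empty expansion (`f₀ = 0`). -/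
structure IsPOLKRun (loss : ℝ → Y → ℝ) (lam : ℝ) (η ε : ℕ → ℝ) (z : ℕ → X × Y)
    (A : ℕ → KernelExpansion X) : Prop where
  start : (A 0).order = 0
  step : ∀ t, KOMP H (ε t) (sgdStep H loss lam (η t) (A t) (z t).1 (z t).2) (A (t + 1))

/-- The regularized expected risk `R(f) = E[ℓ(f(x), y)] + (λ/2) ‖f‖²` for `(x, y) ∼ P`. -/
noncomputable def regularizedRisk [MeasurableSpace X] [MeasurableSpace Y] (P : Measure (X × Y))
    (loss : ℝ → Y → ℝ) (lam : ℝ) (f : H) : ℝ :=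
  ∫ q, loss (f q.1) q.2 ∂P + lam / 2 * ‖f‖ ^ 2

end RKHSNotions

/-!
Ties in KOMP are broken arbitrarily, so the iterates `f_t` need not be measurable functions of the
sample, and the usual supermartingale argument on `‖f_t - f*‖²` is not available. It is applied
instead to `e_t`, the linear recursion `e_{t+1} = (1 - η_t λ) e_t - η_t v_t` driven by the
stochastic gradients `v_t` of the regularized risk at the *fixed* point `f*`. These have mean zero
because `f*` is a minimizer, so `e_t → 0` almost surely. The rest is pathwise. KOMP moves the
gradient step by at most `ε_t`, and convexity of the loss makes its gradient monotone, so that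
`‖f_t - f* - e_t‖²` contracts by the factor `1 - η_t λ` up to an error `o(η_t)`; since
`∑ η_t = ∞`, it tends to zero.
-/

section Recursion

theorem tendsto_zero_of_le_one_sub_mul {v a : ℕ → ℝ} (hv : ∀ n, 0 ≤ v n)
    (ha : Tendsto (fun n => ∑ k ∈ Finset.range n, a k) atTop atTop)
    (h : ∀ᶠ n in atTop, v (n + 1) ≤ (1 - a n) * v n) : Tendsto v atTop (𝓝 0) := by
  obtain ⟨N, hN⟩ := eventually_atTop.1 h
  set σ : ℕ → ℝ := fun n => ∑ k ∈ Finset.range n, a k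
  have hbound : ∀ n ≥ N, v n ≤ v N * Real.exp (σ N - σ n) := by
    intro n hn
    induction n, hn using Nat.le_induction with
    | base => simp
    | succ n hn ih =>
      calc v (n + 1) ≤ (1 - a n) * v n := hN n hn
        _ ≤ Real.exp (-a n) * v n := by
          gcongr
          · exact hv n
          · exact Real.one_sub_le_exp_neg (a n)
        _ ≤ Real.exp (-a n) * (v N * Real.exp (σ N - σ n)) := by gcongr
        _ = v N * Real.exp (σ N - σ (n + 1)) := by
          rw [mul_left_comm, ← Real.exp_add]
          simp only [σ, Finset.sum_range_succ]
          ring_nf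
  have hexp : Tendsto (fun n => v N * Real.exp (σ N - σ n)) atTop (𝓝 0) := by
    have hexponent : Tendsto (fun n => σ N - σ n) atTop atBot :=
      tendsto_const_nhds.add_atBot (tendsto_neg_atTop_atBot.comp ha)
    simpa using (Real.tendsto_exp_atBot.comp hexponent).const_mul (v N)
  exact tendsto_of_tendsto_of_tendsto_of_le_of_le' tendsto_const_nhds hexp
    (Eventually.of_forall hv) (eventually_atTop.2 ⟨N, hbound⟩)

theorem tendsto_zero_of_le_one_sub_mul_add_mul {u a b : ℕ → ℝ} (hu : ∀ n, 0 ≤ u n)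
    (ha0 : ∀ n, 0 ≤ a n) (ha1 : ∀ n, a n ≤ 1)
    (ha : Tendsto (fun n => ∑ k ∈ Finset.range n, a k) atTop atTop)
    (hb : Tendsto b atTop (𝓝 0))
    (h : ∀ᶠ n in atTop, u (n + 1) ≤ (1 - a n) * u n + a n * b n) :
    Tendsto u atTop (𝓝 0) := by
  have hexcess : ∀ c > 0, Tendsto (fun n => max (u n - c) 0) atTop (𝓝 0) := by
    intro c hc
    refine tendsto_zero_of_le_one_sub_mul (fun n => le_max_right _ _) ha ?_
    filter_upwards [h, hb.eventually (gt_mem_nhds hc)] with n hn hbn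
    refine max_le ?_ (mul_nonneg (sub_nonneg.2 (ha1 n)) (le_max_right _ _))
    calc u (n + 1) - c ≤ (1 - a n) * (u n - c) + a n * (b n - c) := by linarith
      _ ≤ (1 - a n) * (u n - c) :=
        add_le_of_nonpos_right (mul_nonpos_of_nonneg_of_nonpos (ha0 n) (sub_nonpos.2 hbn.le))
      _ ≤ (1 - a n) * max (u n - c) 0 :=
        mul_le_mul_of_nonneg_left (le_max_left _ _) (sub_nonneg.2 (ha1 n))
  refine tendsto_order.2 ⟨fun c hc => Eventually.of_forall fun n => hc.trans_le (hu n),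
    fun c hc => ?_⟩
  filter_upwards [(hexcess (c / 2) (half_pos hc)).eventually (gt_mem_nhds (half_pos hc))] with n hn
  linarith [le_max_left (u n - c / 2) 0]

theorem tendsto_zero_of_summable_sq {η : ℕ → ℝ} (h : Summable fun t => η t ^ 2) :
    Tendsto η atTop (𝓝 0) := by
  rw [tendsto_zero_iff_abs_tendsto_zero]
  simpa [Function.comp_def, Real.sqrt_sq_eq_abs] using h.tendsto_atTop_zero.sqrt

theorem isLittleO_sq_of_summable_sq {η : ℕ → ℝ} (h : Summable fun t => η t ^ 2) :
    (fun t => η t ^ 2) =o[atTop] η := by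
  have hlim : η =o[atTop] fun _ => (1 : ℝ) :=
    (Asymptotics.isLittleO_one_iff ℝ).2 (tendsto_zero_of_summable_sq h)
  simpa [sq] using hlim.mul_isBigO (Asymptotics.isBigO_refl η atTop)

end Recursion

section Supermartingale

variable {Ω : Type*} {mΩ : MeasurableSpace Ω} {μ : Measure Ω}
  {ℱ : Filtration ℕ mΩ}

theorem eLpNorm_one_eq_ofReal_integral {f : Ω → ℝ} (hf : Integrable f μ) (h0 : 0 ≤ᵐ[μ] f) :
    eLpNorm f 1 μ = ENNReal.ofReal (∫ ω, f ω ∂μ) := by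
  rw [eLpNorm_one_eq_lintegral_enorm, ofReal_integral_eq_lintegral_ofReal hf h0]
  exact lintegral_congr_ae (h0.mono fun ω hω => Real.enorm_of_nonneg hω)

variable [IsFiniteMeasure μ]

theorem ae_tendsto_zero_of_supermartingale {M : ℕ → Ω → ℝ} (hM : Supermartingale M ℱ μ)
    (h0 : ∀ t, 0 ≤ᵐ[μ] M t) (hmean : Tendsto (fun t => ∫ ω, M t ω ∂μ) atTop (𝓝 0)) :
    ∀ᵐ ω ∂μ, Tendsto (fun t => M t ω) atTop (𝓝 0) := by
  have hnorm : ∀ t, eLpNorm (M t) 1 μ = ENNReal.ofReal (∫ ω, M t ω ∂μ) := fun t =>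
    eLpNorm_one_eq_ofReal_integral (hM.integrable t) (h0 t)
  have hbdd : ∀ t, eLpNorm ((-M) t) 1 μ ≤ (∫ ω, M 0 ω ∂μ).toNNReal := fun t => by
    rw [Pi.neg_apply, eLpNorm_neg, hnorm t]
    refine ENNReal.ofReal_le_ofReal ?_
    simpa using hM.setIntegral_le t.zero_le MeasurableSet.univ
  have hmeas : TendstoInMeasure μ M atTop 0 := by
    refine tendstoInMeasure_of_tendsto_eLpNorm one_ne_zero
      (fun t => (hM.integrable t).aestronglyMeasurable) aestronglyMeasurable_zero ?_
    simpa [hnorm] using ENNReal.tendsto_ofReal hmean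
  obtain ⟨ns, hns, hsubseq⟩ := hmeas.exists_seq_tendsto_ae
  filter_upwards [hM.neg.exists_ae_tendsto_of_bdd hbdd, hsubseq] with ω ⟨c, hc⟩ hω
  have hlim : Tendsto (fun t => M t ω) atTop (𝓝 (-c)) := by simpa using hc.neg
  simpa [tendsto_nhds_unique (hlim.comp hns.tendsto_atTop) hω] using hlim

theorem tendsto_integral_zero_of_condExp_succ_le {M : ℕ → Ω → ℝ} {a r : ℕ → ℝ}
    (hM_int : ∀ t, Integrable (M t) μ) (hM0 : ∀ t, 0 ≤ᵐ[μ] M t) (ha0 : ∀ t, 0 ≤ a t)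
    (ha1 : ∀ t, a t ≤ 1) (ha : Tendsto (fun n => ∑ t ∈ Finset.range n, a t) atTop atTop)
    (hr : Tendsto r atTop (𝓝 0))
    (h : ∀ t, μ[M (t + 1) | ℱ t] ≤ᵐ[μ] fun ω => (1 - a t) * M t ω + a t * r t) :
    Tendsto (fun t => ∫ ω, M t ω ∂μ) atTop (𝓝 0) := by
  refine tendsto_zero_of_le_one_sub_mul_add_mul (b := fun t => μ.real Set.univ * r t)
    (fun t => integral_nonneg_of_ae (hM0 t)) ha0 ha1 ha
    (by simpa using hr.const_mul (μ.real Set.univ)) (Eventually.of_forall fun t => ?_)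
  calc ∫ ω, M (t + 1) ω ∂μ = ∫ ω, (μ[M (t + 1) | ℱ t]) ω ∂μ := (integral_condExp (ℱ.le t)).symm
    _ ≤ ∫ ω, ((1 - a t) * M t ω + a t * r t) ∂μ :=
      integral_mono_ae integrable_condExp (((hM_int t).const_mul _).add (integrable_const _)) (h t)
    _ = (1 - a t) * ∫ ω, M t ω ∂μ + a t * (μ.real Set.univ * r t) := by
      rw [integral_add ((hM_int t).const_mul _) (integrable_const _), integral_const_mul,
        integral_const, smul_eq_mul]
      ring

theorem ae_tendsto_zero_of_condExp_succ_le {Q : ℕ → Ω → ℝ} {a c : ℕ → ℝ}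
    (hQ_adapted : StronglyAdapted ℱ Q) (hQ_int : ∀ t, Integrable (Q t) μ)
    (hQ0 : ∀ t, 0 ≤ᵐ[μ] Q t) (ha0 : ∀ t, 0 ≤ a t) (ha1 : ∀ t, a t ≤ 1)
    (ha : Tendsto (fun n => ∑ t ∈ Finset.range n, a t) atTop atTop)
    (hc0 : ∀ t, 0 ≤ c t) (hc : Summable c)
    (h : ∀ t, μ[Q (t + 1) | ℱ t] ≤ᵐ[μ] fun ω => (1 - a t) * Q t ω + c t) :
    ∀ᵐ ω ∂μ, Tendsto (fun t => Q t ω) atTop (𝓝 0) := by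
  -- Adding the tail sums of `c` turns `Q` into a supermartingale.
  set r : ℕ → ℝ := fun t => ∑' k, c (k + t)
  have hr0 : ∀ t, 0 ≤ r t := fun t => tsum_nonneg fun k => hc0 _
  have hr : Tendsto r atTop (𝓝 0) := tendsto_sum_nat_add c
  have hr_succ : ∀ t, r t = c t + r (t + 1) := fun t => by
    simpa [r, add_assoc, add_comm 1 t] using ((summable_nat_add_iff t).2 hc).tsum_eq_zero_add
  set M : ℕ → Ω → ℝ := fun t ω => Q t ω + r t
  have hM_int : ∀ t, Integrable (M t) μ := fun t => (hQ_int t).add (integrable_const _)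
  have hM_nonneg : ∀ t, 0 ≤ᵐ[μ] M t := fun t => (hQ0 t).mono fun ω hω => add_nonneg hω (hr0 t)
  have hM_step : ∀ t, μ[M (t + 1) | ℱ t] ≤ᵐ[μ] fun ω => (1 - a t) * M t ω + a t * r t := fun t => by
    filter_upwards [condExp_add (hQ_int (t + 1)) (integrable_const (r (t + 1))) (ℱ t), h t]
      with ω hadd hω
    rw [show M (t + 1) = Q (t + 1) + fun _ => r (t + 1) from rfl, hadd, Pi.add_apply,
      condExp_const (ℱ.le t)]
    linarith [hr_succ t]
  have hM : Supermartingale M ℱ μ := by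
    refine supermartingale_nat (fun t => (hQ_adapted t).add stronglyMeasurable_const) hM_int
      fun t => ?_
    filter_upwards [hM_step t, hQ0 t] with ω hω hQω
    have hr_le : a t * r t ≤ a t * M t ω :=
      mul_le_mul_of_nonneg_left (le_add_of_nonneg_left hQω) (ha0 t)
    linarith
  have hmean : Tendsto (fun t => ∫ ω, M t ω ∂μ) atTop (𝓝 0) :=
    tendsto_integral_zero_of_condExp_succ_le hM_int hM_nonneg ha0 ha1 ha hr hM_step
  filter_upwards [ae_tendsto_zero_of_supermartingale hM hM_nonneg hmean] with ω hω
  simpa [M] using hω.sub hr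

end Supermartingale

section DampedSum

variable {H : Type*} [NormedAddCommGroup H] [InnerProductSpace ℝ H]

/-- The damped accumulation `e₀ = 0`, `e_{t+1} = (1 - a_t) e_t - η_t v_t` of a sequence `v`, which
is the error that the noise `v` leaves in a stochastic approximation scheme with contraction
factors `1 - a_t` and step sizes `η_t`. -/
noncomputable def dampedSum (a η : ℕ → ℝ) (v : ℕ → H) : ℕ → H
  | 0 => 0
  | t + 1 => (1 - a t) • dampedSum a η v t - η t • v t

variable {a η : ℕ → ℝ} {B : ℝ}

theorem norm_dampedSum_le {v : ℕ → H} (ha0 : ∀ t, 0 ≤ a t) (ha1 : ∀ t, a t ≤ 1)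
    (hv : ∀ t, ‖v t‖ ≤ B) (t : ℕ) :
    ‖dampedSum a η v t‖ ≤ (∑ s ∈ Finset.range t, |η s|) * B := by
  induction t with
  | zero => simp [dampedSum]
  | succ t ih =>
    have hcontract : ‖(1 - a t) • dampedSum a η v t‖ ≤ ‖dampedSum a η v t‖ := by
      rw [norm_smul, Real.norm_of_nonneg (sub_nonneg.2 (ha1 t))]
      exact mul_le_of_le_one_left (norm_nonneg _) (sub_le_self 1 (ha0 t))
    have hnoise : ‖η t • v t‖ ≤ |η t| * B := by
      rw [norm_smul, Real.norm_eq_abs]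
      gcongr
      exact hv t
    rw [Finset.sum_range_succ, add_mul]
    exact (norm_sub_le _ _).trans (add_le_add (hcontract.trans ih) hnoise)

theorem norm_smul_sub_smul_sq (c s : ℝ) (u w : H) :
    ‖c • u - s • w‖ ^ 2 =
      c ^ 2 * ‖u‖ ^ 2 - 2 * (c * s) * inner ℝ u w + s ^ 2 * ‖w‖ ^ 2 := by
  rw [norm_sub_sq_real, norm_smul, norm_smul, real_inner_smul_left, real_inner_smul_right,
    mul_pow, mul_pow, Real.norm_eq_abs, Real.norm_eq_abs, sq_abs, sq_abs]
  ring

theorem inner_dampedSum_succ (v : ℕ → H) (n : ℕ) (w : H) :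
    inner ℝ (dampedSum a η v (n + 1)) w =
      (1 - a n) * inner ℝ (dampedSum a η v n) w - η n * inner ℝ (v n) w := by
  rw [dampedSum, inner_sub_left, real_inner_smul_left, real_inner_smul_left]

theorem norm_sq_dampedSum_succ (v : ℕ → H) (t : ℕ) :
    ‖dampedSum a η v (t + 1)‖ ^ 2 = (1 - a t) ^ 2 * ‖dampedSum a η v t‖ ^ 2 -
      2 * ((1 - a t) * η t) * inner ℝ (dampedSum a η v t) (v t) + η t ^ 2 * ‖v t‖ ^ 2 :=
  norm_smul_sub_smul_sq _ _ _ _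

variable {Ω : Type*} {mΩ : MeasurableSpace Ω}

/-- A martingale difference sequence in the weak sense needed for second moments: each term is
conditionally orthogonal to the earlier ones. Measurability is asked only of the scalar products,
since the terms of `v` need not be strongly measurable when `H` is not separable. -/
structure IsWeakMartingaleDifference (v : ℕ → Ω → H) (ℱ : Filtration ℕ mΩ) (μ : Measure Ω) :
    Prop where
  stronglyMeasurable_inner : ∀ {s t u}, s < u → t < u →
    StronglyMeasurable[ℱ u] fun ω => inner ℝ (v s ω) (v t ω)
  condExp_inner : ∀ {s t}, s < t → μ[fun ω => inner ℝ (v s ω) (v t ω) | ℱ t] =ᵐ[μ] 0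

namespace IsWeakMartingaleDifference

variable {v : ℕ → Ω → H} {ℱ : Filtration ℕ mΩ} {μ : Measure Ω}

theorem stronglyMeasurable_inner_dampedSum (h : IsWeakMartingaleDifference v ℱ μ) {n m : ℕ}
    (hnm : n ≤ m) :
    StronglyMeasurable[ℱ (m + 1)] fun ω => inner ℝ (dampedSum a η (v · ω) n) (v m ω) := by
  induction n with
  | zero => simpa only [dampedSum, inner_zero_left] using stronglyMeasurable_const
  | succ n ih =>
    simp only [inner_dampedSum_succ]
    exact ((ih (by lia)).const_mul _).sub
      ((h.stronglyMeasurable_inner (by lia) (by lia)).const_mul _)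

theorem stronglyAdapted_norm_sq_dampedSum (h : IsWeakMartingaleDifference v ℱ μ) :
    StronglyAdapted ℱ fun t ω => ‖dampedSum a η (v · ω) t‖ ^ 2 := by
  intro t
  induction t with
  | zero => simpa only [dampedSum] using stronglyMeasurable_const
  | succ t ih =>
    simp only [norm_sq_dampedSum_succ, ← real_inner_self_eq_norm_sq (v t _)]
    have hpast := (ih.mono (ℱ.mono t.le_succ)).const_mul ((1 - a t) ^ 2)
    have hcross := (h.stronglyMeasurable_inner_dampedSum (a := a) (η := η) (le_refl t)).const_mul
      (2 * ((1 - a t) * η t))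
    have hnew := (h.stronglyMeasurable_inner t.lt_succ_self t.lt_succ_self).const_mul (η t ^ 2)
    exact (hpast.sub hcross).add hnew

variable [IsFiniteMeasure μ]

theorem integrable_inner (h : IsWeakMartingaleDifference v ℱ μ) (hv : ∀ t ω, ‖v t ω‖ ≤ B)
    (s t : ℕ) : Integrable (fun ω => inner ℝ (v s ω) (v t ω)) μ := by
  refine Integrable.of_bound ((h.stronglyMeasurable_inner (u := s + t + 1) (by lia) (by lia)).mono
    (ℱ.le _)).aestronglyMeasurable (B * B) (Eventually.of_forall fun ω => ?_)
  exact (norm_inner_le_norm _ _).trans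
    (mul_le_mul (hv s ω) (hv t ω) (norm_nonneg _) ((norm_nonneg _).trans (hv s ω)))

theorem integrable_inner_dampedSum (h : IsWeakMartingaleDifference v ℱ μ)
    (hv : ∀ t ω, ‖v t ω‖ ≤ B) (n t : ℕ) :
    Integrable (fun ω => inner ℝ (dampedSum a η (v · ω) n) (v t ω)) μ := by
  induction n with
  | zero => simp [dampedSum]
  | succ n ih =>
    simp only [inner_dampedSum_succ]
    exact (ih.const_mul _).sub ((h.integrable_inner hv n t).const_mul _)

theorem integrable_norm_sq_dampedSum (h : IsWeakMartingaleDifference v ℱ μ)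
    (ha0 : ∀ t, 0 ≤ a t) (ha1 : ∀ t, a t ≤ 1) (hv : ∀ t ω, ‖v t ω‖ ≤ B) (t : ℕ) :
    Integrable (fun ω => ‖dampedSum a η (v · ω) t‖ ^ 2) μ := by
  refine Integrable.of_bound
    ((h.stronglyAdapted_norm_sq_dampedSum t).mono (ℱ.le t)).aestronglyMeasurable
    (((∑ s ∈ Finset.range t, |η s|) * B) ^ 2) (Eventually.of_forall fun ω => ?_)
  rw [Real.norm_of_nonneg (sq_nonneg _)]
  gcongr
  exact norm_dampedSum_le ha0 ha1 (hv · ω) t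

theorem condExp_inner_dampedSum (h : IsWeakMartingaleDifference v ℱ μ)
    (hv : ∀ t ω, ‖v t ω‖ ≤ B) {n t : ℕ} (hnt : n ≤ t) :
    μ[fun ω => inner ℝ (dampedSum a η (v · ω) n) (v t ω) | ℱ t] =ᵐ[μ] 0 := by
  induction n with
  | zero => simp only [dampedSum, inner_zero_left, condExp_const (ℱ.le t)]; rfl
  | succ n ih =>
    simp only [inner_dampedSum_succ]
    filter_upwards [condExp_sub ((h.integrable_inner_dampedSum hv n t).const_mul (1 - a n))
        ((h.integrable_inner hv n t).const_mul (η n)) (ℱ t),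
      condExp_smul (μ := μ) (1 - a n)
        (fun ω => inner ℝ (dampedSum a η (v · ω) n) (v t ω)) (ℱ t),
      condExp_smul (μ := μ) (η n) (fun ω => inner ℝ (v n ω) (v t ω)) (ℱ t),
      ih (by lia), h.condExp_inner (s := n) (t := t) (by lia)]
      with ω hsub hsmul₁ hsmul₂ hih hnew
    refine hsub.trans ?_
    simp only [Pi.smul_def, smul_eq_mul] at hsmul₁ hsmul₂
    simp [hsmul₁, hsmul₂, hih, hnew]

theorem condExp_norm_sq_dampedSum_succ_le (h : IsWeakMartingaleDifference v ℱ μ)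
    (ha0 : ∀ t, 0 ≤ a t) (ha1 : ∀ t, a t ≤ 1) (hv : ∀ t ω, ‖v t ω‖ ≤ B) (t : ℕ) :
    μ[fun ω => ‖dampedSum a η (v · ω) (t + 1)‖ ^ 2 | ℱ t] ≤ᵐ[μ]
      fun ω => (1 - a t) * ‖dampedSum a η (v · ω) t‖ ^ 2 + η t ^ 2 * B ^ 2 := by
  set Q : ℕ → Ω → ℝ := fun t ω => ‖dampedSum a η (v · ω) t‖ ^ 2
  set I : Ω → ℝ := fun ω => inner ℝ (dampedSum a η (v · ω) t) (v t ω)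
  set c : ℝ := 2 * ((1 - a t) * η t)
  have hQ_int : ∀ t, Integrable (Q t) μ := h.integrable_norm_sq_dampedSum ha0 ha1 hv
  have hmain_int : Integrable (fun ω => (1 - a t) * Q t ω + η t ^ 2 * B ^ 2) μ :=
    ((hQ_int t).const_mul _).add (integrable_const _)
  have hcross_int : Integrable (c • I) μ := (h.integrable_inner_dampedSum hv t t).smul c
  have hstep : Q (t + 1) ≤ (fun ω => (1 - a t) * Q t ω + η t ^ 2 * B ^ 2) - c • I := fun ω => by
    have hdamp : (1 - a t) ^ 2 * Q t ω ≤ (1 - a t) * Q t ω :=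
      mul_le_mul_of_nonneg_right (by nlinarith [ha0 t, ha1 t]) (sq_nonneg _)
    have hnoise : η t ^ 2 * ‖v t ω‖ ^ 2 ≤ η t ^ 2 * B ^ 2 := by
      gcongr
      exact hv t ω
    have hQ_succ : Q (t + 1) ω = _ := norm_sq_dampedSum_succ (v · ω) t
    simp only [Pi.sub_apply, Pi.smul_apply, smul_eq_mul, c, I]
    linarith
  have hmain_meas : StronglyMeasurable[ℱ t] fun ω => (1 - a t) * Q t ω + η t ^ 2 * B ^ 2 :=
    ((h.stronglyAdapted_norm_sq_dampedSum t).const_mul _).add stronglyMeasurable_const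
  filter_upwards [condExp_mono (m := ℱ t) (hQ_int (t + 1)) (hmain_int.sub hcross_int)
      (Eventually.of_forall hstep), condExp_sub hmain_int hcross_int (ℱ t),
    condExp_smul (μ := μ) c I (ℱ t), h.condExp_inner_dampedSum (a := a) (η := η) hv le_rfl]
    with ω hmono hsub hsmul hcross
  refine hmono.trans_eq (hsub.trans ?_)
  rw [Pi.sub_apply, hsmul, Pi.smul_apply, hcross,
    condExp_of_stronglyMeasurable (ℱ.le t) hmain_meas hmain_int]
  simp [Q]

theorem ae_tendsto_dampedSum (h : IsWeakMartingaleDifference v ℱ μ)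
    (hv : ∀ t ω, ‖v t ω‖ ≤ B) (ha0 : ∀ t, 0 ≤ a t) (ha1 : ∀ t, a t ≤ 1)
    (ha : Tendsto (fun n => ∑ t ∈ Finset.range n, a t) atTop atTop)
    (hη_sq : Summable fun t => η t ^ 2) :
    ∀ᵐ ω ∂μ, Tendsto (dampedSum a η (v · ω)) atTop (𝓝 0) := by
  filter_upwards [ae_tendsto_zero_of_condExp_succ_le h.stronglyAdapted_norm_sq_dampedSum
    (h.integrable_norm_sq_dampedSum ha0 ha1 hv) (fun t => Eventually.of_forall fun ω => sq_nonneg _)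
    ha0 ha1 ha (fun t => by positivity) (hη_sq.mul_right (B ^ 2))
    (h.condExp_norm_sq_dampedSum_succ_le ha0 ha1 hv)] with ω hω
  rw [tendsto_zero_iff_norm_tendsto_zero]
  simpa [Real.sqrt_sq (norm_nonneg _)] using hω.sqrt

end IsWeakMartingaleDifference

end DampedSum

section IndependentNoise

variable {Ω : Type*} {mΩ : MeasurableSpace Ω} {μ : Measure Ω}
  {S : Type*} [mS : MeasurableSpace S]

/-- The samples `Z s` with `s < t`, as a single random vector. -/
def history (Z : ℕ → Ω → S) (t : ℕ) (ω : Ω) (s : Finset.range t) : S := Z s ω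

theorem measurable_history {Z : ℕ → Ω → S} (hZ : ∀ t, Measurable (Z t)) (t : ℕ) :
    Measurable (history Z t) :=
  measurable_pi_iff.2 fun s => hZ s

/-- The filtration of the strict past of a process: at time `t` only the samples `Z s` with `s < t`
are known. -/
def pastFiltration (Z : ℕ → Ω → S) (hZ : ∀ t, Measurable (Z t)) : Filtration ℕ mΩ where
  seq t := MeasurableSpace.comap (history Z t) inferInstance
  mono' t u htu := by
    have hrestrict : Measurable fun (w : Finset.range u → S) (s : Finset.range t) =>
        w ⟨s, Finset.range_mono htu s.2⟩ := measurable_pi_iff.2 fun s => measurable_pi_apply _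
    exact (hrestrict.comp (comap_measurable (history Z u))).comap_le
  le' t := (measurable_history hZ t).comap_le

theorem measurable_pastFiltration {Z : ℕ → Ω → S} (hZ : ∀ t, Measurable (Z t)) {s t : ℕ}
    (hst : s < t) : Measurable[pastFiltration Z hZ t] (Z s) :=
  (measurable_pi_apply (⟨s, Finset.mem_range.2 hst⟩ : Finset.range t)).comp
    (comap_measurable (history Z t))

theorem indepFun_history {Z : ℕ → Ω → S} (hZ : ∀ t, Measurable (Z t)) (hindep : iIndepFun Z μ)
    (t : ℕ) : history Z t ⟂ᵢ[μ] Z t :=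
  (hindep.indepFun_finset (Finset.range t) {t} (by simp) hZ).comp measurable_id
    (measurable_pi_apply (⟨t, Finset.mem_singleton_self t⟩ : ({t} : Finset ℕ)))

variable [IsProbabilityMeasure μ]

theorem condExp_comp_prodMk_of_indepFun {α : Type*} [mα : MeasurableSpace α] {W : Ω → α}
    {Z : Ω → S} (hW : Measurable W) (hZ : Measurable Z) (hWZ : W ⟂ᵢ[μ] Z) {F : α × S → ℝ}
    (hF : StronglyMeasurable F) (hF_int : Integrable F ((μ.map W).prod (μ.map Z))) :
    μ[fun ω => F (W ω, Z ω) | mα.comap W] =ᵐ[μ] fun ω => ∫ z, F (W ω, z) ∂μ.map Z := by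
  have hlaw : μ.map (fun ω => (W ω, Z ω)) = (μ.map W).prod (μ.map Z) :=
    hWZ.map_prod_eq_prod_map_map hW.aemeasurable hZ.aemeasurable
  have hint : Integrable (fun ω => F (W ω, Z ω)) μ := by
    rw [← hlaw] at hF_int
    exact hF_int.comp_measurable (hW.prodMk hZ)
  have hmean_meas : StronglyMeasurable fun w => ∫ z, F (w, z) ∂μ.map Z := hF.integral_prod_right'
  have : IsProbabilityMeasure (μ.map Z) := Measure.isProbabilityMeasure_map hZ.aemeasurable
  have hmean_int : Integrable (fun ω => ∫ z, F (W ω, z) ∂μ.map Z) μ :=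
    hF_int.integral_prod_left.comp_measurable hW
  refine (ae_eq_condExp_of_forall_setIntegral_eq hW.comap_le hint
    (fun _ _ _ => hmean_int.integrableOn) ?_
    (hmean_meas.comp_measurable (comap_measurable W)).aestronglyMeasurable).symm
  rintro _ ⟨B, hB, rfl⟩ -
  calc ∫ ω in W ⁻¹' B, ∫ z, F (W ω, z) ∂μ.map Z ∂μ
      = ∫ w in B, ∫ z, F (w, z) ∂μ.map Z ∂μ.map W :=
        (setIntegral_map hB hmean_meas.aestronglyMeasurable hW.aemeasurable).symm
    _ = ∫ q in B ×ˢ Set.univ, F q ∂(μ.map W).prod (μ.map Z) := by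
        rw [setIntegral_prod F hF_int.integrableOn, Measure.restrict_univ]
    _ = ∫ ω in W ⁻¹' B, F (W ω, Z ω) ∂μ := by
        rw [← hlaw, setIntegral_map (hB.prod MeasurableSet.univ) hF.aestronglyMeasurable
          (hW.prodMk hZ).aemeasurable, Set.prod_univ]
        rfl

variable {H : Type*} [NormedAddCommGroup H] [InnerProductSpace ℝ H]

theorem isWeakMartingaleDifference_of_iIndepFun {Z : ℕ → Ω → S} (hZ : ∀ t, Measurable (Z t))
    (hindep : iIndepFun Z μ) {ξ : S → H} {B : ℝ}
    (hξ_meas : Measurable fun q : S × S => inner ℝ (ξ q.1) (ξ q.2)) (hξ : ∀ z, ‖ξ z‖ ≤ B)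
    (hξ_mean : ∀ z t, ∫ z', inner ℝ (ξ z) (ξ z') ∂μ.map (Z t) = 0) :
    IsWeakMartingaleDifference (fun t ω => ξ (Z t ω)) (pastFiltration Z hZ) μ where
  stronglyMeasurable_inner hs ht :=
    (hξ_meas.comp ((measurable_pastFiltration hZ hs).prodMk
      (measurable_pastFiltration hZ ht))).stronglyMeasurable
  condExp_inner {s t} hst := by
    have hW : Measurable (history Z t) := measurable_history hZ t
    let pair (q : (Finset.range t → S) × S) : S × S := (q.1 ⟨s, Finset.mem_range.2 hst⟩, q.2)
    have hpair : Measurable pair := by fun_prop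
    have hF : StronglyMeasurable fun q => inner ℝ (ξ (pair q).1) (ξ (pair q).2) :=
      (hξ_meas.comp hpair).stronglyMeasurable
    have := Measure.isProbabilityMeasure_map (μ := μ) hW.aemeasurable
    have := Measure.isProbabilityMeasure_map (μ := μ) (hZ t).aemeasurable
    have hF_int : Integrable (fun q => inner ℝ (ξ (pair q).1) (ξ (pair q).2))
        ((μ.map (history Z t)).prod (μ.map (Z t))) :=
      Integrable.of_bound hF.aestronglyMeasurable (B * B) (Eventually.of_forall fun q =>
        (norm_inner_le_norm _ _).trans (mul_le_mul (hξ _) (hξ _) (norm_nonneg _)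
          ((norm_nonneg _).trans (hξ q.2))))
    refine (condExp_comp_prodMk_of_indepFun hW (hZ t) (indepFun_history hZ hindep t) hF
      hF_int).trans (Eventually.of_forall fun ω => ?_)
    exact hξ_mean _ t

end IndependentNoise

section MonotoneStochasticApproximation

variable {H : Type*} [NormedAddCommGroup H] [InnerProductSpace ℝ H]

theorem norm_smul_sub_smul_sq_le {c s M : ℝ} (hc0 : 0 ≤ c) (hc1 : c ≤ 1) (hs : 0 ≤ s)
    {u e w : H} (hw : ‖w‖ ≤ M) (hmono : 0 ≤ inner ℝ (u + e) w) :
    ‖c • u - s • w‖ ^ 2 ≤ c ^ 2 * ‖u‖ ^ 2 + s * (2 * (‖e‖ * M) + s * M ^ 2) := by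
  have hinner : -(‖e‖ * M) ≤ inner ℝ u w := by
    have hew : inner ℝ e w ≤ ‖e‖ * M :=
      (real_inner_le_norm e w).trans (mul_le_mul_of_nonneg_left hw (norm_nonneg e))
    rw [inner_add_left] at hmono
    linarith
  have heM : 0 ≤ ‖e‖ * M := mul_nonneg (norm_nonneg e) ((norm_nonneg w).trans hw)
  have hcross : -(2 * (c * s) * inner ℝ u w) ≤ s * (2 * (‖e‖ * M)) := by
    calc -(2 * (c * s) * inner ℝ u w) = 2 * (c * s) * -inner ℝ u w := by ring
      _ ≤ 2 * (c * s) * (‖e‖ * M) := by gcongr; linarith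
      _ ≤ 2 * (1 * s) * (‖e‖ * M) := by gcongr
      _ = s * (2 * (‖e‖ * M)) := by ring
  have hsq : s ^ 2 * ‖w‖ ^ 2 ≤ s ^ 2 * M ^ 2 := by gcongr
  rw [norm_smul_sub_smul_sq]
  linarith

theorem add_mul_sq_le_one_sub_mul_add {x d r b η lam : ℝ} (hlam : 0 < lam) (hη : 0 ≤ η)
    (hη1 : η * lam ≤ 1) (hb : 0 ≤ b) (hx : x ^ 2 ≤ (1 - η * lam) ^ 2 * d ^ 2 + η * b) :
    (x + r * η) ^ 2 ≤
      (1 - η * lam) * d ^ 2 + η * lam * ((2 * b + r ^ 2 * (lam⁻¹ + η)) / lam) := by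
  have hyoung : 2 * x * (r * η) ≤ η * lam * x ^ 2 + η * (r ^ 2 * lam⁻¹) := by
    have hsq : 0 ≤ η * lam⁻¹ * (lam * x - r) ^ 2 := by positivity
    have hexpand : η * lam⁻¹ * (lam * x - r) ^ 2 =
        η * lam * x ^ 2 - 2 * x * (r * η) + η * (r ^ 2 * lam⁻¹) := by field_simp; ring
    linarith
  have hscaled : (1 + η * lam) * x ^ 2 ≤ (1 - η * lam) * d ^ 2 + 2 * (η * b) := by
    have hfactor : (1 + η * lam) * (1 - η * lam) ^ 2 ≤ 1 - η * lam := by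
      nlinarith [mul_nonneg (sub_nonneg.2 hη1) (sq_nonneg (η * lam))]
    calc (1 + η * lam) * x ^ 2
        ≤ (1 + η * lam) * ((1 - η * lam) ^ 2 * d ^ 2 + η * b) := by gcongr
      _ = (1 + η * lam) * (1 - η * lam) ^ 2 * d ^ 2 + (1 + η * lam) * (η * b) := by ring
      _ ≤ (1 - η * lam) * d ^ 2 + 2 * (η * b) := by gcongr; linarith
  have hcancel : η * lam * ((2 * b + r ^ 2 * (lam⁻¹ + η)) / lam) =
      2 * (η * b) + η * (r ^ 2 * lam⁻¹) + (r * η) ^ 2 := by field_simp; ring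
  rw [hcancel]
  linarith

variable {lam M : ℝ} {η ε : ℕ → ℝ}

theorem tendsto_of_tendsto_dampedSum (hlam : 0 < lam) (hη0 : ∀ t, 0 ≤ η t)
    (hη1 : ∀ t, η t * lam ≤ 1) (hη : Tendsto η atTop (𝓝 0))
    (hη_sum : Tendsto (fun n => ∑ t ∈ Finset.range n, η t) atTop atTop) (hε : ε =o[atTop] η)
    {f p q : ℕ → H} {g : H} (hmono : ∀ t, 0 ≤ inner ℝ (f t - g) (p t - q t))
    (hbdd : ∀ t, ‖p t - q t‖ ≤ M)
    (hstep : ∀ t, ‖f (t + 1) - ((1 - η t * lam) • f t - η t • p t)‖ ≤ ε t)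
    (hnoise : Tendsto (dampedSum (fun t => η t * lam) η fun t => lam • g + q t) atTop (𝓝 0)) :
    Tendsto f atTop (𝓝 g) := by
  set e := dampedSum (fun t => η t * lam) η fun t => lam • g + q t
  set u : ℕ → H := fun t => f t - (g + e t)
  obtain ⟨r, hr, hεr⟩ := Asymptotics.isLittleO_iff_exists_eq_mul.1 hε
  set b : ℕ → ℝ := fun t => 2 * (‖e t‖ * M) + η t * M ^ 2
  have hM : 0 ≤ M := (norm_nonneg _).trans (hbdd 0)
  have hb0 : ∀ t, 0 ≤ b t := fun t => by have := hη0 t; positivity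
  have hb : Tendsto b atTop (𝓝 0) := by
    simpa using ((hnoise.norm.mul_const M).const_mul 2).add (hη.mul_const (M ^ 2))
  have hu_succ : ∀ t, ‖u (t + 1)‖ ≤
      ‖(1 - η t * lam) • u t - η t • (p t - q t)‖ + ε t := fun t => by
    have hsplit : u (t + 1) = (1 - η t * lam) • u t - η t • (p t - q t) +
        (f (t + 1) - ((1 - η t * lam) • f t - η t • p t)) := by
      simp only [u, e, dampedSum]
      module
    rw [hsplit]
    exact (norm_add_le _ _).trans (by gcongr; exact hstep t)
  have hcontract : ∀ᶠ t in atTop, ‖u (t + 1)‖ ^ 2 ≤ (1 - η t * lam) * ‖u t‖ ^ 2 +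
      η t * lam * ((2 * b t + r t ^ 2 * (lam⁻¹ + η t)) / lam) := by
    filter_upwards [hεr] with t ht
    refine (pow_le_pow_left₀ (norm_nonneg _) (hu_succ t) 2).trans ?_
    rw [ht, Pi.mul_apply]
    refine add_mul_sq_le_one_sub_mul_add hlam (hη0 t) (hη1 t) (hb0 t)
      (norm_smul_sub_smul_sq_le (sub_nonneg.2 (hη1 t))
        (sub_le_self 1 (mul_nonneg (hη0 t) hlam.le)) (hη0 t) (hbdd t) ?_)
    simpa [u, sub_add_eq_sub_sub] using hmono t
  have hu_sq : Tendsto (fun t => ‖u t‖ ^ 2) atTop (𝓝 0) := by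
    refine tendsto_zero_of_le_one_sub_mul_add_mul (fun t => sq_nonneg _)
      (fun t => mul_nonneg (hη0 t) hlam.le) hη1 ?_ ?_ hcontract
    · simpa only [Finset.sum_mul] using hη_sum.atTop_mul_const hlam
    · simpa using ((hb.const_mul 2).add ((hr.pow 2).mul (hη.const_add lam⁻¹))).div_const lam
  have hu : Tendsto u atTop (𝓝 0) := by
    rw [tendsto_zero_iff_norm_tendsto_zero]
    simpa [Real.sqrt_sq (norm_nonneg _)] using hu_sq.sqrt
  simpa [u] using hu.add (hnoise.const_add g)

theorem ae_tendsto_of_iIndepFun {Ω : Type*} [MeasurableSpace Ω] {μ : Measure Ω}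
    [IsProbabilityMeasure μ] {S : Type*} [MeasurableSpace S] {Z : ℕ → Ω → S}
    (hZ : ∀ t, Measurable (Z t)) (hindep : iIndepFun Z μ) (hlam : 0 < lam) (hη0 : ∀ t, 0 ≤ η t)
    (hη_sum : Tendsto (fun n => ∑ t ∈ Finset.range n, η t) atTop atTop)
    (hη_sq : Summable fun t => η t ^ 2) (hε : ε =o[atTop] η) {G : S → H → H} {g : H}
    (hG_mono : ∀ z f, 0 ≤ inner ℝ (f - g) (G z f - G z g)) (hG_bdd : ∀ z f, ‖G z f‖ ≤ M)
    (hG_meas : Measurable fun q : S × S => inner ℝ (lam • g + G q.1 g) (lam • g + G q.2 g))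
    (hG_mean : ∀ z t, ∫ z', inner ℝ (lam • g + G z g) (lam • g + G z' g) ∂μ.map (Z t) = 0)
    {f : ℕ → Ω → H} (hstep : ∀ᵐ ω ∂μ, ∀ t,
      ‖f (t + 1) ω - ((1 - η t * lam) • f t ω - η t • G (Z t ω) (f t ω))‖ ≤ ε t) :
    ∀ᵐ ω ∂μ, Tendsto (f · ω) atTop (𝓝 g) := by
  have hη : Tendsto η atTop (𝓝 0) := tendsto_zero_of_summable_sq hη_sq
  obtain ⟨N, hN⟩ : ∃ N, ∀ t ≥ N, η t * lam ≤ 1 :=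
    eventually_atTop.1 ((hη.mul_const lam).eventually_le_const (by simp))
  have hη1 : ∀ t, η (t + N) * lam ≤ 1 := fun t => hN _ (Nat.le_add_left N t)
  have hη_sum' : Tendsto (fun n => ∑ t ∈ Finset.range n, η (t + N)) atTop atTop := by
    have hsplit : ∀ n, ∑ t ∈ Finset.range n, η (t + N) =
        ∑ t ∈ Finset.range (n + N), η t - ∑ t ∈ Finset.range N, η t := fun n => by
      rw [add_comm n N, Finset.sum_range_add, add_sub_cancel_left]
      simp only [add_comm N]
    simpa only [hsplit, sub_eq_add_neg] using tendsto_atTop_add_const_right _ _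
      ((tendsto_add_atTop_iff_nat N).2 hη_sum)
  have hdiff : IsWeakMartingaleDifference (fun t ω => lam • g + G (Z (t + N) ω) g)
      (pastFiltration (fun t => Z (t + N)) fun t => hZ (t + N)) μ :=
    isWeakMartingaleDifference_of_iIndepFun (fun t => hZ (t + N))
      (hindep.precomp (g := (· + N)) (add_left_injective N)) hG_meas
      (fun z => norm_add_le_of_le le_rfl (hG_bdd z g)) fun z t => hG_mean z (t + N)
  have hnoise := hdiff.ae_tendsto_dampedSum (a := fun t => η (t + N) * lam)
    (η := fun t => η (t + N)) (fun t ω => norm_add_le_of_le le_rfl (hG_bdd (Z (t + N) ω) g))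
    (fun t => mul_nonneg (hη0 _) hlam.le) hη1
    (by simpa only [Finset.sum_mul] using hη_sum'.atTop_mul_const hlam)
    ((summable_nat_add_iff N).2 hη_sq)
  filter_upwards [hnoise, hstep] with ω hω hstepω
  refine (tendsto_add_atTop_iff_nat N).1 (tendsto_of_tendsto_dampedSum hlam (fun t => hη0 (t + N))
    hη1 ((tendsto_add_atTop_iff_nat N).2 hη) hη_sum' (hε.comp_tendsto (tendsto_add_atTop_nat N))
    (fun t => hG_mono (Z (t + N) ω) (f (t + N) ω))
    (fun t => norm_sub_le_of_le (hG_bdd _ _) (hG_bdd _ _)) (fun t => ?_) hω)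
  simpa only [Function.comp_apply, add_right_comm] using hstepω (t + N)

end MonotoneStochasticApproximation

section Loss

variable {Y : Type*} {loss : ℝ → Y → ℝ} {C : ℝ}

theorem hasDerivAt_lossDeriv (hloss_diff : ∀ y, Differentiable ℝ fun z => loss z y) (z : ℝ)
    (y : Y) : HasDerivAt (fun u => loss u y) (lossDeriv loss z y) z :=
  (hloss_diff y z).hasDerivAt

theorem monotone_lossDeriv (hloss_convex : ∀ y, ConvexOn ℝ Set.univ fun z => loss z y)
    (hloss_diff : ∀ y, Differentiable ℝ fun z => loss z y) (y : Y) :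
    Monotone fun z => lossDeriv loss z y :=
  monotoneOn_univ.1 ((hloss_convex y).monotoneOn_deriv fun z _ => hloss_diff y z)

theorem abs_lossDeriv_le (hloss_lip : ∀ y z z', |loss z y - loss z' y| ≤ C * |z - z'|) (z : ℝ)
    (y : Y) : |lossDeriv loss z y| ≤ C := by
  have hC : 0 ≤ C := by simpa using (abs_nonneg _).trans (hloss_lip y 1 0)
  have hlip : LipschitzWith C.toNNReal fun z => loss z y :=
    LipschitzWith.of_dist_le' fun z z' => hloss_lip y z z'
  simpa [lossDeriv, hC] using norm_deriv_le_of_lipschitz (x₀ := z) hlip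

theorem measurable_lossDeriv [MeasurableSpace Y] (hloss_meas : ∀ z, Measurable (loss z))
    (hloss_diff : ∀ y, Differentiable ℝ fun z => loss z y) :
    Measurable fun q : ℝ × Y => lossDeriv loss q.1 q.2 := by
  have hloss : Measurable (Function.uncurry loss) :=
    measurable_uncurry_of_continuous_of_measurable (fun y => (hloss_diff y).continuous) hloss_meas
  set s : ℕ → ℝ := fun n => 1 / (n + 1)
  have hs : Tendsto s atTop (𝓝[≠] 0) :=
    tendsto_nhdsWithin_iff.2 ⟨tendsto_one_div_add_atTop_nhds_zero_nat,
      Eventually.of_forall fun n => Nat.one_div_pos_of_nat.ne'⟩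
  have hslope_meas : ∀ n, Measurable fun q : ℝ × Y =>
      (s n)⁻¹ • (loss (q.1 + s n) q.2 - loss q.1 q.2) := fun n => by
    have hshift : Measurable fun q : ℝ × Y => loss (q.1 + s n) q.2 :=
      hloss.comp ((measurable_fst.add_const (s n)).prodMk measurable_snd)
    exact (hshift.sub hloss).const_smul (s n)⁻¹
  exact measurable_of_tendsto_metrizable hslope_meas (tendsto_pi_nhds.2 fun q =>
    (hasDerivAt_lossDeriv hloss_diff q.1 q.2).tendsto_slope_zero.comp hs)

end Loss

section Kernel

variable {X : Type*} {H : Type*} [NormedAddCommGroup H] [InnerProductSpace ℝ H] [CompleteSpace H]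
  [RKHS ℝ H X ℝ]

theorem inner_kernelSection_kernelSection (x x' : X) :
    inner ℝ (kernelSection H x) (kernelSection H x') = reproducingKernel H x' x := by
  rw [inner_kernelSection, reproducingKernel_eq_kernelSection_apply]

theorem norm_kernelSection (x : X) : ‖kernelSection H x‖ = √(reproducingKernel H x x) := by
  rw [← inner_kernelSection_kernelSection, real_inner_self_eq_norm_sq, Real.sqrt_sq (norm_nonneg _)]

theorem exists_norm_kernelSection_le
    (hκ : BddAbove (Set.range fun x : X => √(reproducingKernel H x x))) :
    ∃ K, ∀ x, ‖kernelSection H x‖ ≤ K := by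
  simpa [bddAbove_def, norm_kernelSection] using hκ

theorem measurable_coe_of_measurable_reproducingKernel [MeasurableSpace X]
    (hκ : ∀ x', Measurable fun x => reproducingKernel H x x') (f : H) : Measurable ⇑f := by
  have hspan : ∀ g ∈ Submodule.span ℝ {RKHS.kerFun H x v | (x : X) (v : ℝ)},
      Measurable ⇑g := fun g hg => by
    induction hg using Submodule.span_induction with
    | mem g hg =>
      obtain ⟨x, v, rfl⟩ := hg
      have hsmul : RKHS.kerFun H x v = v • kernelSection H x := by
        rw [kernelSection, ← map_smul, smul_eq_mul, mul_one]
      rw [hsmul, RKHS.coe_smul]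
      simp only [reproducingKernel_eq_kernelSection_apply] at hκ
      exact (hκ x).const_smul v
    | zero => rw [RKHS.coe_zero]; exact measurable_const
    | add g g' _ _ hg hg' => rw [RKHS.coe_add]; exact hg.add hg'
    | smul c g _ hg => rw [RKHS.coe_smul]; exact hg.const_smul c
  have hf : f ∈ (Submodule.span ℝ {RKHS.kerFun H x v | (x : X) (v : ℝ)}).topologicalClosure := by
    rw [RKHS.kerFun_dense]
    exact Submodule.mem_top
  obtain ⟨u, hu, hlim⟩ := mem_closure_iff_seq_limit.1 hf
  exact measurable_of_tendsto_metrizable (fun n => hspan (u n) (hu n))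
    (tendsto_pi_nhds.2 fun x => ((RKHS.continuous_eval x).tendsto f).comp hlim)

end Kernel

section LossGradient

variable {X Y : Type*} {H : Type*} [NormedAddCommGroup H] [InnerProductSpace ℝ H] [CompleteSpace H]
  [RKHS ℝ H X ℝ]

/-- The gradient at `f`, in the Hilbert space `H`, of the loss `f ↦ ℓ(f(x), y)` on the sample
`q = (x, y)`. -/
noncomputable def lossGradient (loss : ℝ → Y → ℝ) (q : X × Y) (f : H) : H :=
  lossDeriv loss (f q.1) q.2 • kernelSection H q.1

variable {loss : ℝ → Y → ℝ} {C K lam : ℝ}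

theorem inner_lossGradient (g : H) (q : X × Y) (f : H) :
    inner ℝ g (lossGradient loss q f) = lossDeriv loss (f q.1) q.2 * g q.1 := by
  rw [lossGradient, real_inner_smul_right, inner_kernelSection]

theorem norm_lossGradient_le (hloss_lip : ∀ y z z', |loss z y - loss z' y| ≤ C * |z - z'|)
    (hK : ∀ x, ‖kernelSection H x‖ ≤ K) (q : X × Y) (f : H) :
    ‖lossGradient loss q f‖ ≤ C * K := by
  have hderiv : |lossDeriv loss (f q.1) q.2| ≤ C := abs_lossDeriv_le hloss_lip _ _
  rw [lossGradient, norm_smul, Real.norm_eq_abs]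
  exact mul_le_mul hderiv (hK _) (norm_nonneg _) ((abs_nonneg _).trans hderiv)

theorem inner_sub_lossGradient_sub_nonneg
    (hloss_convex : ∀ y, ConvexOn ℝ Set.univ fun z => loss z y)
    (hloss_diff : ∀ y, Differentiable ℝ fun z => loss z y) (q : X × Y) (f g : H) :
    0 ≤ inner ℝ (f - g) (lossGradient loss q f - lossGradient loss q g) := by
  rw [inner_sub_right, inner_lossGradient, inner_lossGradient, ← sub_mul, RKHS.coe_sub,
    Pi.sub_apply]
  rcases le_total (f q.1) (g q.1) with hfg | hgf
  · exact mul_nonneg_of_nonpos_of_nonpos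
      (sub_nonpos.2 (monotone_lossDeriv hloss_convex hloss_diff q.2 hfg)) (sub_nonpos.2 hfg)
  · exact mul_nonneg (sub_nonneg.2 (monotone_lossDeriv hloss_convex hloss_diff q.2 hgf))
      (sub_nonneg.2 hgf)

theorem abs_loss_sub_le (hloss_lip : ∀ y z z', |loss z y - loss z' y| ≤ C * |z - z'|)
    (hK : ∀ x, ‖kernelSection H x‖ ≤ K) (q : X × Y) (f g : H) :
    |loss (f q.1) q.2 - loss (g q.1) q.2| ≤ C * K * ‖f - g‖ := by
  have hC : 0 ≤ C := (abs_nonneg _).trans (abs_lossDeriv_le hloss_lip 0 q.2)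
  have heval : |f q.1 - g q.1| ≤ ‖f - g‖ * K := by
    rw [← Pi.sub_apply, ← RKHS.coe_sub, ← inner_kernelSection]
    exact (abs_real_inner_le_norm _ _).trans (mul_le_mul_of_nonneg_left (hK _) (norm_nonneg _))
  calc |loss (f q.1) q.2 - loss (g q.1) q.2| ≤ C * |f q.1 - g q.1| := hloss_lip _ _ _
    _ ≤ C * (‖f - g‖ * K) := mul_le_mul_of_nonneg_left heval hC
    _ = C * K * ‖f - g‖ := by ring

theorem hasDerivAt_loss_add_smul (hloss_diff : ∀ y, Differentiable ℝ fun z => loss z y) (f g : H)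
    (q : X × Y) :
    HasDerivAt (fun s : ℝ => loss ((f + s • g) q.1) q.2) (inner ℝ g (lossGradient loss q f)) 0 := by
  have hline : HasDerivAt (fun s : ℝ => f q.1 + s * g q.1) (g q.1) 0 := by
    simpa using ((hasDerivAt_id (0 : ℝ)).mul_const (g q.1)).const_add (f q.1)
  have hloss := hasDerivAt_lossDeriv hloss_diff (f q.1 + 0 * g q.1) q.2
  simpa [Function.comp_def, inner_lossGradient] using hloss.comp (0 : ℝ) hline

variable [MeasurableSpace X] [MeasurableSpace Y]

theorem measurable_lossDeriv_apply (hκ : ∀ x', Measurable fun x => reproducingKernel H x x')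
    (hloss_meas : ∀ z, Measurable (loss z))
    (hloss_diff : ∀ y, Differentiable ℝ fun z => loss z y) (f : H) :
    Measurable fun q : X × Y => lossDeriv loss (f q.1) q.2 :=
  (measurable_lossDeriv hloss_meas hloss_diff).comp
    (((measurable_coe_of_measurable_reproducingKernel hκ f).comp measurable_fst).prodMk
      measurable_snd)

theorem measurable_inner_lossGradient (hκ : ∀ x', Measurable fun x => reproducingKernel H x x')
    (hloss_meas : ∀ z, Measurable (loss z))
    (hloss_diff : ∀ y, Differentiable ℝ fun z => loss z y) (f g : H) :
    Measurable fun q : X × Y => inner ℝ g (lossGradient loss q f) := by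
  simp only [inner_lossGradient]
  exact (measurable_lossDeriv_apply hκ hloss_meas hloss_diff f).mul
    ((measurable_coe_of_measurable_reproducingKernel hκ g).comp measurable_fst)

theorem measurable_inner_add_lossGradient
    (hκ : Measurable fun q : X × X => reproducingKernel H q.1 q.2)
    (hloss_meas : ∀ z, Measurable (loss z))
    (hloss_diff : ∀ y, Differentiable ℝ fun z => loss z y) (f g : H) :
    Measurable fun q : (X × Y) × (X × Y) =>
      inner ℝ (g + lossGradient loss q.1 f) (g + lossGradient loss q.2 f) := by
  have hκ' : ∀ x' : X, Measurable fun x : X => reproducingKernel H x x' := fun x' =>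
    hκ.of_uncurry_right
  have hinner : Measurable fun q : X × Y => inner ℝ g (lossGradient loss q f) :=
    measurable_inner_lossGradient hκ' hloss_meas hloss_diff f g
  have hderiv : Measurable fun q : X × Y => lossDeriv loss (f q.1) q.2 :=
    measurable_lossDeriv_apply hκ' hloss_meas hloss_diff f
  have hkernel : Measurable fun q : (X × Y) × (X × Y) => reproducingKernel H q.2.1 q.1.1 := by
    fun_prop
  have hexpand : ∀ q q' : X × Y,
      inner ℝ (g + lossGradient loss q f) (g + lossGradient loss q' f) =
        inner ℝ g g + inner ℝ g (lossGradient loss q f) + (inner ℝ g (lossGradient loss q' f) +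
          lossDeriv loss (f q.1) q.2 *
            (lossDeriv loss (f q'.1) q'.2 * reproducingKernel H q'.1 q.1)) := fun q q' => by
    simp only [lossGradient, inner_add_left, inner_add_right, real_inner_smul_left,
      real_inner_smul_right, inner_kernelSection_kernelSection, real_inner_comm g]
    ring
  simp only [hexpand]
  have hfst : Measurable fun q : (X × Y) × (X × Y) => q.1 := measurable_fst
  have hsnd : Measurable fun q : (X × Y) × (X × Y) => q.2 := measurable_snd
  exact ((hinner.comp hfst).const_add _).add ((hinner.comp hsnd).add
    ((hderiv.comp hfst).mul ((hderiv.comp hsnd).mul hkernel)))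

end LossGradient

section Risk

variable {X Y : Type*} {H : Type*} [NormedAddCommGroup H] [InnerProductSpace ℝ H] [CompleteSpace H]
  [RKHS ℝ H X ℝ] [MeasurableSpace X] [MeasurableSpace Y] {P : Measure (X × Y)} [IsFiniteMeasure P]
  {loss : ℝ → Y → ℝ} {C K lam : ℝ}

theorem lipschitzWith_integral_loss
    (hloss_lip : ∀ y z z', |loss z y - loss z' y| ≤ C * |z - z'|)
    (hK : ∀ x, ‖kernelSection H x‖ ≤ K)
    (hrisk : ∀ f : H, Integrable (fun q : X × Y => loss (f q.1) q.2) P) :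
    LipschitzWith (C * K * P.real Set.univ).toNNReal
      fun f : H => ∫ q, loss (f q.1) q.2 ∂P := by
  refine LipschitzWith.of_dist_le' fun f g => ?_
  rw [dist_eq_norm, dist_eq_norm, ← integral_sub (hrisk f) (hrisk g), mul_right_comm]
  exact norm_integral_le_of_norm_le_const
    (Eventually.of_forall fun q => abs_loss_sub_le hloss_lip hK q f g)

theorem continuous_regularizedRisk
    (hloss_lip : ∀ y z z', |loss z y - loss z' y| ≤ C * |z - z'|)
    (hK : ∀ x, ‖kernelSection H x‖ ≤ K)
    (hrisk : ∀ f : H, Integrable (fun q : X × Y => loss (f q.1) q.2) P) :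
    Continuous (regularizedRisk P loss lam : H → ℝ) :=
  (lipschitzWith_integral_loss hloss_lip hK hrisk).continuous.add
    (continuous_const.mul (continuous_norm.pow 2))

theorem integrable_inner_lossGradient
    (hκ : ∀ x', Measurable fun x => reproducingKernel H x x')
    (hK : ∀ x, ‖kernelSection H x‖ ≤ K) (hloss_meas : ∀ z, Measurable (loss z))
    (hloss_lip : ∀ y z z', |loss z y - loss z' y| ≤ C * |z - z'|)
    (hloss_diff : ∀ y, Differentiable ℝ fun z => loss z y) (f g : H) :
    Integrable (fun q : X × Y => inner ℝ g (lossGradient loss q f)) P :=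
  Integrable.of_bound
    (measurable_inner_lossGradient hκ hloss_meas hloss_diff f g).aestronglyMeasurable
    (‖g‖ * (C * K)) (Eventually.of_forall fun q => (norm_inner_le_norm _ _).trans
      (mul_le_mul_of_nonneg_left (norm_lossGradient_le hloss_lip hK q f) (norm_nonneg g)))

theorem hasDerivAt_integral_loss_add_smul
    (hκ : ∀ x', Measurable fun x => reproducingKernel H x x')
    (hK : ∀ x, ‖kernelSection H x‖ ≤ K) (hloss_meas : ∀ z, Measurable (loss z))
    (hloss_lip : ∀ y z z', |loss z y - loss z' y| ≤ C * |z - z'|)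
    (hloss_diff : ∀ y, Differentiable ℝ fun z => loss z y)
    (hrisk : ∀ f : H, Integrable (fun q : X × Y => loss (f q.1) q.2) P) (f g : H) :
    HasDerivAt (fun s : ℝ => ∫ q, loss ((f + s • g) q.1) q.2 ∂P)
      (∫ q, inner ℝ g (lossGradient loss q f) ∂P) 0 := by
  refine (hasDerivAt_integral_of_dominated_loc_of_lip (bound := fun _ => C * K * ‖g‖) univ_mem
    (Eventually.of_forall fun s => (hrisk (f + s • g)).aestronglyMeasurable) (hrisk (f + 0 • g))
    (measurable_inner_lossGradient hκ hloss_meas hloss_diff f g).aestronglyMeasurable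
    (Eventually.of_forall fun q => LipschitzOnWith.of_dist_le_mul fun s _ s' _ => ?_)
    (integrable_const _)
    (Eventually.of_forall (hasDerivAt_loss_add_smul hloss_diff f g))).2
  calc |loss ((f + s • g) q.1) q.2 - loss ((f + s' • g) q.1) q.2|
      ≤ C * K * ‖f + s • g - (f + s' • g)‖ := abs_loss_sub_le hloss_lip hK q _ _
    _ = C * K * ‖g‖ * dist s s' := by
      rw [add_sub_add_left_eq_sub, ← sub_smul, norm_smul, Real.dist_eq, Real.norm_eq_abs]
      ring
    _ ≤ Real.nnabs (C * K * ‖g‖) * dist s s' := by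
      rw [Real.coe_nnabs]
      gcongr
      exact le_abs_self _

theorem hasDerivAt_regularizedRisk_add_smul
    (hκ : ∀ x', Measurable fun x => reproducingKernel H x x')
    (hK : ∀ x, ‖kernelSection H x‖ ≤ K) (hloss_meas : ∀ z, Measurable (loss z))
    (hloss_lip : ∀ y z z', |loss z y - loss z' y| ≤ C * |z - z'|)
    (hloss_diff : ∀ y, Differentiable ℝ fun z => loss z y)
    (hrisk : ∀ f : H, Integrable (fun q : X × Y => loss (f q.1) q.2) P) (f g : H) :
    HasDerivAt (fun s : ℝ => regularizedRisk P loss lam (f + s • g))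
      (∫ q, inner ℝ g (lossGradient loss q f) ∂P + lam * inner ℝ g f) 0 := by
  have hline : HasDerivAt (fun s : ℝ => f + s • g) g 0 := by
    simpa using ((hasDerivAt_id (0 : ℝ)).smul_const g).const_add f
  have hnorm : HasDerivAt (fun s : ℝ => lam / 2 * ‖f + s • g‖ ^ 2) (lam * inner ℝ g f) 0 := by
    refine (hline.norm_sq.const_mul (lam / 2)).congr_deriv ?_
    rw [zero_smul, add_zero, real_inner_comm]
    ring
  exact (hasDerivAt_integral_loss_add_smul hκ hK hloss_meas hloss_lip hloss_diff hrisk f g).add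
    hnorm

theorem integral_inner_smul_add_lossGradient_eq_zero {P : Measure (X × Y)}
    [IsProbabilityMeasure P] (hκ : ∀ x', Measurable fun x => reproducingKernel H x x')
    (hK : ∀ x, ‖kernelSection H x‖ ≤ K) (hloss_meas : ∀ z, Measurable (loss z))
    (hloss_lip : ∀ y z z', |loss z y - loss z' y| ≤ C * |z - z'|)
    (hloss_diff : ∀ y, Differentiable ℝ fun z => loss z y)
    (hrisk : ∀ f : H, Integrable (fun q : X × Y => loss (f q.1) q.2) P) {f : H}
    (hf : ∀ g : H, regularizedRisk P loss lam f ≤ regularizedRisk P loss lam g) (g : H) :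
    ∫ q, inner ℝ g (lam • f + lossGradient loss q f) ∂P = 0 := by
  have hmin : IsLocalMin (fun s : ℝ => regularizedRisk P loss lam (f + s • g)) 0 :=
    Eventually.of_forall fun s => by simpa using hf (f + s • g)
  have hcritical : ∫ q, inner ℝ g (lossGradient loss q f) ∂P + lam * inner ℝ g f = 0 :=
    hmin.hasDerivAt_eq_zero
      (hasDerivAt_regularizedRisk_add_smul hκ hK hloss_meas hloss_lip hloss_diff hrisk f g)
  simp only [inner_add_right, real_inner_smul_right]
  rw [integral_add (integrable_const _)
    (integrable_inner_lossGradient hκ hK hloss_meas hloss_lip hloss_diff f g), integral_const,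
    probReal_univ, one_smul, add_comm]
  exact hcritical

end Risk

section KOMPError

variable {X : Type*} {H : Type*} [NormedAddCommGroup H] [InnerProductSpace ℝ H] [CompleteSpace H]
  [RKHS ℝ H X ℝ]

theorem KOMPLoop.norm_sub_le {g : H} {ε : ℝ} {A B : KernelExpansion X} (h : KOMPLoop g ε A B)
    (hA : ‖g - A.toRKHS H‖ ≤ ε) : ‖g - B.toRKHS H‖ ≤ ε := by
  induction h with
  | empty => exact hA
  | halt => exact hA
  | prune _ _ _ _ within _ refit _ _ ih => exact ih ((le_ciInf refit).trans within)

theorem KOMP.norm_sub_le {ε : ℝ} (hε : 0 ≤ ε) {A B : KernelExpansion X} (h : KOMP H ε A B) :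
    ‖A.toRKHS H - B.toRKHS H‖ ≤ ε :=
  KOMPLoop.norm_sub_le h (by simpa using hε)

end KOMPError

theorem ae_tendsto_of_norm_sub_gradientStep_le {X Y : Type*} [MeasurableSpace X]
    [MeasurableSpace Y] {H : Type*} [NormedAddCommGroup H] [InnerProductSpace ℝ H]
    [CompleteSpace H] [RKHS ℝ H X ℝ]
    (hκ : Measurable fun q : X × X => reproducingKernel H q.1 q.2) {K : ℝ}
    (hK : ∀ x, ‖kernelSection H x‖ ≤ K) {loss : ℝ → Y → ℝ} {C : ℝ}
    (hloss_meas : ∀ z, Measurable (loss z))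
    (hloss_lip : ∀ y z z', |loss z y - loss z' y| ≤ C * |z - z'|)
    (hloss_convex : ∀ y, ConvexOn ℝ Set.univ fun z => loss z y)
    (hloss_diff : ∀ y, Differentiable ℝ fun z => loss z y)
    {Ω : Type*} [MeasurableSpace Ω] {μ : Measure Ω} [IsProbabilityMeasure μ]
    {P : Measure (X × Y)} [IsProbabilityMeasure P] {Z : ℕ → Ω → X × Y}
    (hZ_meas : ∀ t, Measurable (Z t)) (hZ_indep : iIndepFun Z μ) (hZ_law : ∀ t, μ.map (Z t) = P)
    (hrisk : ∀ f : H, Integrable (fun q : X × Y => loss (f q.1) q.2) P)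
    {lam : ℝ} (hlam : 0 < lam) {η ε : ℕ → ℝ} (hη_nonneg : ∀ t, 0 ≤ η t)
    (hη_sum : Tendsto (fun n => ∑ t ∈ Finset.range n, η t) atTop atTop)
    (hη_sq : Summable fun t => η t ^ 2) (hε : ε =o[atTop] η) {fstar : H}
    (hfstar : ∀ f : H, regularizedRisk P loss lam fstar ≤ regularizedRisk P loss lam f)
    {f : ℕ → Ω → H} (hstep : ∀ᵐ ω ∂μ, ∀ t, ‖f (t + 1) ω -
      ((1 - η t * lam) • f t ω - η t • lossGradient loss (Z t ω) (f t ω))‖ ≤ ε t) :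
    ∀ᵐ ω ∂μ, Tendsto (f · ω) atTop (𝓝 fstar) := by
  have hκ_section : ∀ x' : X, Measurable fun x : X => reproducingKernel H x x' := fun x' =>
    hκ.of_uncurry_right
  refine ae_tendsto_of_iIndepFun hZ_meas hZ_indep hlam hη_nonneg hη_sum hη_sq hε
    (fun q f => inner_sub_lossGradient_sub_nonneg hloss_convex hloss_diff q f fstar)
    (norm_lossGradient_le hloss_lip hK)
    (measurable_inner_add_lossGradient hκ hloss_meas hloss_diff fstar (lam • fstar))
    (fun q t => ?_) hstep
  rw [hZ_law t]
  exact integral_inner_smul_add_lossGradient_eq_zero hκ_section hK hloss_meas hloss_lip hloss_diff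
    hrisk hfstar _

theorem theorem1_general {X Y : Type*} [MeasurableSpace X] [MeasurableSpace Y]
    {H : Type*} [NormedAddCommGroup H] [InnerProductSpace ℝ H] [CompleteSpace H] [RKHS ℝ H X ℝ]
    (hκ_meas : Measurable fun q : X × X => reproducingKernel H q.1 q.2)
    (hκ_bdd : BddAbove (Set.range fun x : X => √(reproducingKernel H x x)))
    {loss : ℝ → Y → ℝ} {C : ℝ} (hloss_meas : ∀ z, Measurable (loss z))
    (hloss_lip : ∀ y z z', |loss z y - loss z' y| ≤ C * |z - z'|)
    (hloss_convex : ∀ y, ConvexOn ℝ Set.univ fun z => loss z y)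
    (hloss_diff : ∀ y, Differentiable ℝ fun z => loss z y)
    {Ω : Type*} [MeasurableSpace Ω] {μ : Measure Ω} [IsProbabilityMeasure μ]
    {P : Measure (X × Y)} {Z : ℕ → Ω → X × Y} (hZ_meas : ∀ t, Measurable (Z t))
    (hZ_indep : iIndepFun Z μ) (hZ_law : ∀ t, μ.map (Z t) = P)
    (hrisk : ∀ f : H, Integrable (fun q : X × Y => loss (f q.1) q.2) P)
    {lam : ℝ} (hlam : 0 < lam) {η ε : ℕ → ℝ} (hη_nonneg : ∀ t, 0 ≤ η t)
    (hη_sum : Tendsto (fun n => ∑ t ∈ Finset.range n, η t) atTop atTop)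
    (hη_sq : Summable fun t => η t ^ 2) (hε_nonneg : ∀ t, 0 ≤ ε t) (hε : ε =o[atTop] η) {fstar : H}
    (hfstar : ∀ f : H, regularizedRisk P loss lam fstar ≤ regularizedRisk P loss lam f)
    {A : ℕ → Ω → KernelExpansion X}
    (hA : ∀ᵐ ω ∂μ, IsPOLKRun H loss lam η ε (fun t => Z t ω) (fun t => A t ω)) :
    (∀ᵐ ω ∂μ, Tendsto (fun t => regularizedRisk P loss lam ((A t ω).toRKHS H) -
      regularizedRisk P loss lam fstar) atTop (𝓝 0)) ∧
    (∀ᵐ ω ∂μ, Tendsto (fun t => ‖(A t ω).toRKHS H - fstar‖ ^ 2) atTop (𝓝 0)) := by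
  have : IsProbabilityMeasure P :=
    hZ_law 0 ▸ Measure.isProbabilityMeasure_map (hZ_meas 0).aemeasurable
  obtain ⟨K, hK⟩ := exists_norm_kernelSection_le hκ_bdd
  have hstep : ∀ᵐ ω ∂μ, ∀ t, ‖(A (t + 1) ω).toRKHS H - ((1 - η t * lam) • (A t ω).toRKHS H -
      η t • lossGradient loss (Z t ω) ((A t ω).toRKHS H))‖ ≤ ε t := hA.mono fun ω hω t => by
    rw [norm_sub_rev, lossGradient, smul_smul, ← toRKHS_sgdStep]
    exact (hω.step t).norm_sub_le (hε_nonneg t)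
  have hlim := ae_tendsto_of_norm_sub_gradientStep_le hκ_meas hK hloss_meas hloss_lip hloss_convex
    hloss_diff hZ_meas hZ_indep hZ_law hrisk hlam hη_nonneg hη_sum hη_sq hε hfstar
    (f := fun t ω => (A t ω).toRKHS H) hstep
  refine ⟨hlim.mono fun ω hω => ?_, hlim.mono fun ω hω => ?_⟩
  · exact tendsto_sub_nhds_zero_iff.2
      (((continuous_regularizedRisk hloss_lip hK hrisk).tendsto fstar).comp hω)
  · simpa using (tendsto_iff_norm_sub_tendsto_zero.1 hω).pow 2

theorem theorem1
    -- compact feature and target domains, and an RKHS of functions on the feature space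
    {p : ℕ} (𝒳 : Set (EuclideanSpace ℝ (Fin p))) (h𝒳 : IsCompact 𝒳)
    (𝒴 : Set ℝ) (h𝒴 : IsCompact 𝒴)
    {H : Type*} [NormedAddCommGroup H] [InnerProductSpace ℝ H] [CompleteSpace H] [RKHS ℝ H 𝒳 ℝ]
    (hκ_meas : Measurable fun q : 𝒳 × 𝒳 => reproducingKernel H q.1 q.2)
    (hκ_bdd : BddAbove (Set.range fun x : 𝒳 => √(reproducingKernel H x x)))
    -- the loss: uniformly Lipschitz, convex and differentiable in its scalar argument
    (loss : ℝ → 𝒴 → ℝ) (C : ℝ)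
    (hloss_meas : ∀ z, Measurable (loss z))
    (hloss_lip : ∀ y z z', |loss z y - loss z' y| ≤ C * |z - z'|)
    (hloss_convex : ∀ y, ConvexOn ℝ Set.univ fun z => loss z y)
    (hloss_diff : ∀ y, Differentiable ℝ fun z => loss z y)
    -- independent training pairs with common law `P`, for which the risk is finite
    {Ω : Type*} [MeasurableSpace Ω] (μ : Measure Ω) [IsProbabilityMeasure μ]
    (P : Measure (𝒳 × 𝒴)) (Z : ℕ → Ω → 𝒳 × 𝒴)
    (hZ_meas : ∀ t, Measurable (Z t)) (hZ_indep : iIndepFun Z μ)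
    (hZ_law : ∀ t, μ.map (Z t) = P)
    (hrisk : ∀ f : H, Integrable (fun q : 𝒳 × 𝒴 => loss (f q.1) q.2) P)
    -- regularizer, step sizes and approximation budget
    (lam : ℝ) (hlam : 0 < lam) (η ε : ℕ → ℝ)
    (hη_pos : ∀ t, 0 < η t) (hη_lt : ∀ t, η t < 1 / lam)
    (hη_sum : Tendsto (fun n => ∑ t ∈ Finset.range n, η t) atTop atTop)
    (hη_sq : Summable fun t => η t ^ 2)
    (hε : ∀ t, ε t = η t ^ 2)
    -- the minimizer of the regularized expected risk
    (fstar : H)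
    (hfstar : ∀ f : H, regularizedRisk P loss lam fstar ≤ regularizedRisk P loss lam f)
    -- the iterates of POLK
    (A : ℕ → Ω → KernelExpansion 𝒳)
    (hA : ∀ ω, IsPOLKRun H loss lam η ε (fun t => Z t ω) (fun t => A t ω)) :
    (∀ᵐ ω ∂μ,
      liminf (fun t => ((regularizedRisk P loss lam ((A t ω).toRKHS H) -
        regularizedRisk P loss lam fstar : ℝ) : EReal)) atTop = 0) ∧
    (∀ᵐ ω ∂μ, Tendsto (fun t => ‖(A t ω).toRKHS H - fstar‖ ^ 2) atTop (𝓝 0)) := by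
  obtain rfl : ε = fun t => η t ^ 2 := funext hε
  exact (theorem1_general hκ_meas hκ_bdd hloss_meas hloss_lip hloss_convex hloss_diff hZ_meas
    hZ_indep hZ_law hrisk hlam (fun t => (hη_pos t).le) hη_sum hη_sq (fun t => sq_nonneg (η t))
    (isLittleO_sq_of_summable_sq hη_sq) hfstar (Eventually.of_forall hA)).imp_left fun hgap =>
      hgap.mono fun _ hω => ((continuous_coe_real_ereal.tendsto 0).comp hω).liminf_eq
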